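/- **Setting.** Write $X(r,\theta)=(r\cos\theta,r\sin\theta)$. Let $\theta_0\in\mathbb R$, $r_*>0$, and let $r_1,r_2$ be positive continuous functions on $[\theta_0,\infty)$ with $r_2(\theta+2\pi)<r_1(\theta)<r_2(\theta)$ for all $\theta\ge\theta_0$ and $\lim_{\theta\to\infty}r_1(\theta)=\lim_{\theta\to\infty}r_2(\theta)=r_*$. Put $$U=\{X(r,\theta):\theta>\theta_0,\ r_1(\theta)<r<r_2(\theta)\},\qquad \widetilde U=\{X(r,\theta):\theta\ge\theta_0,\ r_1(\theta)\le r\le r_2(\theta)\},$$ $$\mathcal S_\theta=\{X(r,\theta):r_1(\theta)\le r\le r_2(\theta)\},\qquad \gamma=\{X(r_i(\theta),\theta):\theta\ge\theta_0,\ i=1,2\}.$$ Let $A=(a_{ij})$ be a function from $U$ to the symmetric real $2\times2$ matrices such that, for some constants $c_0,M_1>0$, $\xi^{\rm T}A(x)\xi\ge c_0|\xi|^2$ and $\operatorname{Tr}A(x)\le M_1$ for all $x\in U$, $\xi\in\mathbb R^2$; let $b:U\to\mathbb R^2$; and let $$Lu=-\sum_{i,j=1}^2a_{ij}\frac{\partial^2u}{\partial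 x_i\partial x_j}+b\cdot\nabla u .$$ Assume that there are $\bar\Theta\ge\theta_0$, a (weakly) increasing function $m:[\bar\Theta,\infty)\to[0,\infty)$ and $\kappa\in(0,1)$ such that $b$ is bounded on $\{X(r,\theta)\in U:\theta_0<\theta\le\bar\Theta,\ r_1(\theta)<r<r_2(\theta)\}$, $|b(x)|\le m(\theta)$ for all $\theta\ge\bar\Theta$ and $x\in U\cap\mathcal S_\theta$, and $$\lim_{\theta\to\infty}m(\theta)=\infty,\qquad \int_{\bar\Theta}^\infty\kappa^{m(\theta)}\,d\theta=\infty .$$ **Theorem.** There exist numbers $\Theta_0\ge\bar\Theta$ and $\bar\nu>0$ such that for every $u\in C^2(U)\cap C(\widetilde U)$ with $Lu\le0$ in $U$ and $u\le0$ on $\gamma$, writing $u^+=\max\{0,u\}$, one of the following two alternatives holds. (i) For all $\theta\ge\theta_0$, $$\max_{\mathcal S_\theta}u^+\le\Big(\max_{\mathcal S_{\theta_0}}u^+\Big)\min\Big\{1,\exp\Big(-\bar\nu\int_{\Theta_0}^\theta\kappa^{m(\zeta)}\,d\zeta\Big)\Big\},$$ where for $\theta<\Theta_0$ the minimum is understood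 to be $1$; and $\lim_{\theta\to\infty}\max_{\mathcal S_\theta}u^+=0$. (ii) There is $C>0$ (depending on $u$) such that, for all sufficiently large $\theta$, $$\max_{\mathcal S_\theta}u^+\ge C\exp\Big(\bar\nu\int_{\bar\Theta}^\theta\kappa^{m(\zeta)}\,d\zeta\Big);$$ and $\lim_{\theta\to\infty}\max_{\mathcal S_\theta}u^+=\infty$. -/

import Mathlib

open Set Filter Topology MeasureTheory

/-- The Euclidean plane. -/
abbrev Plane : Type := EuclideanSpace ℝ (Fin 2)

/-- Polar coordinates `X(r, θ) = (r cos θ, r sin θ)`. -/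
noncomputable def polarPt (r θ : ℝ) : Plane :=
  !₂[r * Real.cos θ, r * Real.sin θ]

/-- The standing assumptions on the profiles `r₁, r₂` of the spiral domain: positive and continuous
on `[θ₀, ∞)`, `r₂(θ + 2π) < r₁(θ) < r₂(θ)`, and both converge to some `rstar > 0` at infinity. -/
structure IsSpiralProfile (θ₀ rstar : ℝ) (r₁ r₂ : ℝ → ℝ) : Prop where
  pos₁ : ∀ θ, θ₀ ≤ θ → 0 < r₁ θ
  pos₂ : ∀ θ, θ₀ ≤ θ → 0 < r₂ θ
  cont₁ : ContinuousOn r₁ (Ici θ₀)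
  cont₂ : ContinuousOn r₂ (Ici θ₀)
  nest : ∀ θ, θ₀ ≤ θ → r₂ (θ + 2 * Real.pi) < r₁ θ
  lt : ∀ θ, θ₀ ≤ θ → r₁ θ < r₂ θ
  rstar_pos : 0 < rstar
  lim₁ : Tendsto r₁ atTop (𝓝 rstar)
  lim₂ : Tendsto r₂ atTop (𝓝 rstar)

/-- `U_I`: the points `X(r, θ)` with `θ ∈ I` and `r₁(θ) < r < r₂(θ)`. -/
def openSector (r₁ r₂ : ℝ → ℝ) (I : Set ℝ) : Set Plane :=
  {x | ∃ θ ∈ I, ∃ r, r₁ θ < r ∧ r < r₂ θ ∧ x = polarPt r θ}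

/-- The points `X(r, θ)` with `θ ∈ I` and `r₁(θ) ≤ r ≤ r₂(θ)`. -/
def closedSector (r₁ r₂ : ℝ → ℝ) (I : Set ℝ) : Set Plane :=
  {x | ∃ θ ∈ I, ∃ r, r₁ θ ≤ r ∧ r ≤ r₂ θ ∧ x = polarPt r θ}

/-- The spiral domain `U`. -/
def spiralDomain (θ₀ : ℝ) (r₁ r₂ : ℝ → ℝ) : Set Plane :=
  openSector r₁ r₂ (Ioi θ₀)

/-- The set `Ũ`: the domain `U` together with its two bounding curves and its initial section
(but without the limiting circle). -/
def spiralClosed (θ₀ : ℝ) (r₁ r₂ : ℝ → ℝ) : Set Plane :=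
  closedSector r₁ r₂ (Ici θ₀)

/-- The cross-section `S_θ`. -/
def crossSection (r₁ r₂ : ℝ → ℝ) (θ : ℝ) : Set Plane :=
  {x | ∃ r, r₁ θ ≤ r ∧ r ≤ r₂ θ ∧ x = polarPt r θ}

/-- The lateral boundary `γ = γ₁ ∪ γ₂`. -/
def lateralBoundary (θ₀ : ℝ) (r₁ r₂ : ℝ → ℝ) : Set Plane :=
  {x | ∃ θ, θ₀ ≤ θ ∧ x = polarPt (r₁ θ) θ} ∪ {x | ∃ θ, θ₀ ≤ θ ∧ x = polarPt (r₂ θ) θ}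

/-- The classical partial derivative `∂f/∂x_i` at `x` (of a differentiable function). -/
noncomputable def partialD (i : Fin 2) (f : Plane → ℝ) (x : Plane) : ℝ :=
  fderiv ℝ f x (EuclideanSpace.single i 1)

/-- The operator `Lu = -∑ a_ij ∂²u/∂x_i∂x_j + b · ∇u`. -/
noncomputable def driftOp (A : Plane → Matrix (Fin 2) (Fin 2) ℝ) (b : Plane → Plane)
    (u : Plane → ℝ) (x : Plane) : ℝ :=
  -(∑ i, ∑ j, A x i j * partialD i (partialD j u) x) + ∑ i, b x i * partialD i u x

/-- The coefficient matrix is symmetric, uniformly elliptic and of bounded trace in `Ω`. -/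
def IsUniformlyElliptic (A : Plane → Matrix (Fin 2) (Fin 2) ℝ) (Ω : Set Plane) : Prop :=
  (∀ x ∈ Ω, (A x).IsSymm) ∧
    (∃ c₀ : ℝ, 0 < c₀ ∧ ∀ x ∈ Ω, ∀ ξ : Plane, c₀ * ‖ξ‖ ^ 2 ≤ ∑ i, ∑ j, ξ i * A x i j * ξ j) ∧
    (∃ M₁ : ℝ, 0 < M₁ ∧ ∀ x ∈ Ω, (A x).trace ≤ M₁)

/-- The growth assumption on the drift: `b` is bounded on the part of `U` with angle in
`[θ₀, Θbar]`, and on the section of angle `θ ≥ Θbar` it is bounded by `m(θ)`, where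
`m : [Θbar, ∞) → [0, ∞)` is (weakly) increasing to infinity, and `∫_Θbar^∞ κ^{m(θ)} dθ = ∞`.
Only the values of `b` in `U` and those of `m` on `[Θbar, ∞)` matter. -/
structure IsAdmissibleDrift (θ₀ : ℝ) (r₁ r₂ : ℝ → ℝ) (b : Plane → Plane)
    (Θbar : ℝ) (m : ℝ → ℝ) (κ : ℝ) : Prop where
  le_Θbar : θ₀ ≤ Θbar
  nonneg : ∀ θ, Θbar ≤ θ → 0 ≤ m θ
  mono : MonotoneOn m (Ici Θbar)
  bdd : ∃ B : ℝ, ∀ x ∈ spiralDomain θ₀ r₁ r₂ ∩ openSector r₁ r₂ (Icc θ₀ Θbar), ‖b x‖ ≤ B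
  le_m : ∀ θ, Θbar ≤ θ → ∀ x ∈ spiralDomain θ₀ r₁ r₂ ∩ crossSection r₁ r₂ θ, ‖b x‖ ≤ m θ
  lim : Tendsto m atTop atTop
  κ_pos : 0 < κ
  κ_lt_one : κ < 1
  diverges : Tendsto (fun T => ∫ ζ in Θbar..T, κ ^ m ζ) atTop atTop

/-- `max_{x ∈ S_θ} u⁺(x)`; the supremum is attained for `u` continuous on the closed sections. -/
noncomputable def sectionMax (r₁ r₂ : ℝ → ℝ) (u : Plane → ℝ) (θ : ℝ) : ℝ :=
  sSup ((fun x => max 0 (u x)) '' crossSection r₁ r₂ θ)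

/-! Let `M θ` be the maximum of `u⁺` over the section of angle `θ`. The weak maximum principle on
sectors (`sectionMax_le_max`) makes `M` quasiconvex, so `M` is either decreasing throughout or
eventually increasing (`antitoneOn_or_eventually_monotoneOn`).

The rate comes from the barrier `exp (l x·e)`, with `e` the direction of the section of angle `θ`.
It is a strict subsolution once `|b| < c₀ l`. On the sector of angles within 1 of `θ`, normalised to
be at most 1, it is at least `E₁ = exp (-2lδ)` on the central section and at most `E₂ = exp (-l
(rstar + δ) (1 - cos 1))` on the two end sections, where `δ` bounds the distance of the radii from
`rstar`. Comparison gives `M θ ≤ (1 - (E₁ - E₂)) max (M (θ - 1)) (M (θ + 1))`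
(`sectionMax_le_mul_max`).

Since the spiral accumulates on a circle, `δ` may be taken as small as desired. With `l`
proportional to `m`, this makes `E₁ ≥ κ ^ m` for the prescribed `κ`, while `E₂ ≤ E₁²`
(`exists_sectionMax_contraction`). Iterating the factor `1 - κ ^ m / 2` and comparing the product
with an integral gives exponential decay or growth (`decay_of_antitoneOn`, `growth_of_monotoneOn`).
-/

/-! ### Second derivative test -/

/-- A positive second derivative would make the point a local minimum too, hence `g` locally
constant and the second derivative zero. -/
theorem IsLocalMax.deriv_deriv_nonpos {g : ℝ → ℝ} {t : ℝ} (h : IsLocalMax g t)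
    (hc : ContinuousAt g t) : deriv (deriv g) t ≤ 0 := by
  by_contra hpos
  push Not at hpos
  have hmin := isLocalMin_of_deriv_deriv_pos hpos h.deriv_eq_zero hc
  have heq : g =ᶠ[𝓝 t] fun _ => g t := by
    filter_upwards [h, hmin] with s h₁ h₂ using le_antisymm h₁ h₂
  have h0 : deriv (deriv g) t = 0 := by
    rw [heq.deriv.deriv_eq]
    simp
  exact hpos.ne' h0

theorem fderiv_apply_eq_sum_partialD (f : Plane → ℝ) (x ξ : Plane) :
    fderiv ℝ f x ξ = ∑ i, ξ i * partialD i f x := by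
  have hξ : ξ = ∑ i, ξ i • EuclideanSpace.single i (1 : ℝ) := by
    ext j
    fin_cases j <;> simp [Fin.sum_univ_two]
  conv_lhs => rw [hξ]
  simp [partialD, Fin.sum_univ_two]

theorem ContDiffAt.differentiableAt_partialD {f : Plane → ℝ} {x : Plane}
    (hf : ContDiffAt ℝ 2 f x) (i : Fin 2) : DifferentiableAt ℝ (partialD i f) x := by
  have h1 : ContDiffAt ℝ 1 (fderiv ℝ f) x := hf.fderiv_right (by norm_num)
  exact (h1.differentiableAt (by norm_num)).clm_apply (differentiableAt_const _)

theorem ContDiffAt.eventually_differentiableAt {f : Plane → ℝ} {x : Plane}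
    (hf : ContDiffAt ℝ 2 f x) : ∀ᶠ y in 𝓝 x, DifferentiableAt ℝ f y := by
  filter_upwards [hf.eventually (by simp)] with y hy using hy.differentiableAt (by norm_num)

theorem hessian_nonpos_of_isLocalMax {w : Plane → ℝ} {x : Plane} (hw : ContDiffAt ℝ 2 w x)
    (hmax : IsLocalMax w x) (ξ : Plane) :
    ∑ i, ∑ j, ξ i * ξ j * partialD i (partialD j w) x ≤ 0 := by
  have hline : ∀ t : ℝ, HasDerivAt (fun t : ℝ => x + t • ξ) ξ t := fun t => by
    simpa using ((hasDerivAt_id t).smul_const ξ).const_add x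
  have hcont : Tendsto (fun t : ℝ => x + t • ξ) (𝓝 0) (𝓝 x) := by
    have := (hline 0).continuousAt
    simpa [ContinuousAt] using this
  have hg : deriv (fun t : ℝ => w (x + t • ξ)) =ᶠ[𝓝 0]
      fun t => ∑ j, ξ j * partialD j w (x + t • ξ) := by
    filter_upwards [hcont.eventually hw.eventually_differentiableAt] with t ht
    rw [← fderiv_apply_eq_sum_partialD]
    exact (ht.hasFDerivAt.comp_hasDerivAt t (hline t)).deriv
  have hx0 : x + (0 : ℝ) • ξ = x := by simp
  have hd : deriv (deriv fun t : ℝ => w (x + t • ξ)) 0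
      = ∑ j, ξ j * ∑ i, ξ i * partialD i (partialD j w) x := by
    rw [hg.deriv_eq]
    refine HasDerivAt.deriv (HasDerivAt.fun_sum fun j _ => HasDerivAt.const_mul _ ?_)
    rw [← fderiv_apply_eq_sum_partialD]
    have hj : HasFDerivAt (partialD j w) (fderiv ℝ (partialD j w) x) (x + (0 : ℝ) • ξ) := by
      rw [hx0]; exact (hw.differentiableAt_partialD j).hasFDerivAt
    exact hj.comp_hasDerivAt 0 (hline 0)
  have hloc : IsLocalMax (fun t : ℝ => w (x + t • ξ)) 0 := by
    have := hcont.eventually hmax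
    filter_upwards [this] with t ht
    simpa using ht
  have hc : ContinuousAt (fun t : ℝ => w (x + t • ξ)) 0 := by
    have : ContinuousAt w (x + (0 : ℝ) • ξ) := by rw [hx0]; exact hw.continuousAt
    exact this.comp (f := fun t : ℝ => x + t • ξ) (hline 0).continuousAt
  have := hloc.deriv_deriv_nonpos hc
  rw [hd] at this
  simp only [Fin.sum_univ_two] at this ⊢
  linarith

/-- The trace of a product of two positive semidefinite matrices is nonnegative: the discriminants
give `b² ≤ ac` and `q² ≤ pr`, and AM-GM bounds `2|bq|` by `ap + cr`. -/
theorem mul_add_mul_nonneg_of_quadratic_nonneg {a b c p q r : ℝ}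
    (hA : ∀ s t : ℝ, 0 ≤ a * s ^ 2 + 2 * b * s * t + c * t ^ 2)
    (hB : ∀ s t : ℝ, 0 ≤ p * s ^ 2 + 2 * q * s * t + r * t ^ 2) :
    0 ≤ a * p + 2 * b * q + c * r := by
  have ha : 0 ≤ a := by simpa using hA 1 0
  have hp : 0 ≤ p := by simpa using hB 1 0
  have hc : 0 ≤ c := by simpa using hA 0 1
  have hr : 0 ≤ r := by simpa using hB 0 1
  have disc : ∀ {a b c : ℝ}, 0 ≤ a → 0 ≤ c →
      (∀ s t : ℝ, 0 ≤ a * s ^ 2 + 2 * b * s * t + c * t ^ 2) → b ^ 2 ≤ a * c := by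
    intro a b c ha hc h
    have := discrim_le_zero (a := a) (b := 2 * b) (c := c) fun s => by
      have := h s 1; linarith
    rw [discrim] at this
    linarith
  have h1 := disc ha hc hA
  have h2 := disc hp hr hB
  have h3 : (2 * (b * q)) ^ 2 ≤ (a * p + c * r) ^ 2 := by
    have : (b * q) ^ 2 ≤ (a * c) * (p * r) := by
      rw [mul_pow]; exact mul_le_mul h1 h2 (sq_nonneg _) (mul_nonneg ha hc)
    nlinarith [sq_nonneg (a * p - c * r)]
  have := abs_le_of_sq_le_sq' h3 (by positivity)
  linarith [this.1]

theorem driftOp_nonneg_of_isLocalMax {A : Plane → Matrix (Fin 2) (Fin 2) ℝ} {b : Plane → Plane}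
    {w : Plane → ℝ} {x : Plane} (hsymm : (A x).IsSymm)
    (hpos : ∀ ξ : Plane, 0 ≤ ∑ i, ∑ j, ξ i * A x i j * ξ j)
    (hw : ContDiffAt ℝ 2 w x) (hmax : IsLocalMax w x) : 0 ≤ driftOp A b w x := by
  have hgrad : ∀ i, partialD i w x = 0 := fun i => by
    simp [partialD, hmax.fderiv_eq_zero]
  have hess := hessian_nonpos_of_isLocalMax hw hmax
  have hs : A x 1 0 = A x 0 1 := hsymm.apply 0 1
  have key := mul_add_mul_nonneg_of_quadratic_nonneg
    (a := A x 0 0) (b := A x 0 1) (c := A x 1 1)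
    (p := -partialD 0 (partialD 0 w) x)
    -- Averaging the two mixed partials avoids any appeal to their equality.
    (q := -(partialD 0 (partialD 1 w) x + partialD 1 (partialD 0 w) x) / 2)
    (r := -partialD 1 (partialD 1 w) x)
    (fun s t => by
      have := hpos !₂[s, t]
      simp [Fin.sum_univ_two, hs] at this
      linarith)
    (fun s t => by
      have := hess !₂[s, t]
      simp [Fin.sum_univ_two] at this
      linarith)
  simp only [driftOp, hgrad, Fin.sum_univ_two, hs]
  linarith

/-! ### Exponential barriers -/

/-- The exponential of a linear function with gradient `l • e`. -/
noncomputable def expBarrier (l : ℝ) (e x : Plane) : ℝ :=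
  Real.exp (l * ∑ i, x i * e i)

theorem expBarrier_pos (l : ℝ) (e x : Plane) : 0 < expBarrier l e x := Real.exp_pos _

theorem contDiff_expBarrier (l : ℝ) (e : Plane) : ContDiff ℝ 2 (expBarrier l e) := by
  unfold expBarrier
  simp only [Fin.sum_univ_two]
  fun_prop

theorem partialD_const_mul (i : Fin 2) (c : ℝ) {f : Plane → ℝ} {x : Plane}
    (hf : DifferentiableAt ℝ f x) :
    partialD i (fun y => c * f y) x = c * partialD i f x := by
  simp [partialD, fderiv_const_mul hf]

theorem partialD_expBarrier (l : ℝ) (e : Plane) (i : Fin 2) :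
    partialD i (expBarrier l e) = fun x => l * e i * expBarrier l e x := by
  funext x
  have hlin : HasFDerivAt (fun x : Plane => l * ∑ i, x i * e i)
      (l • ∑ i, e i • (EuclideanSpace.proj i : Plane →L[ℝ] ℝ)) x := by
    refine HasFDerivAt.const_mul (HasFDerivAt.fun_sum fun i _ => ?_) l
    exact (EuclideanSpace.proj i : Plane →L[ℝ] ℝ).hasFDerivAt.mul_const (e i)
  have := hlin.exp
  rw [partialD, show expBarrier l e = fun x => Real.exp (l * ∑ i, x i * e i) from rfl, this.fderiv]
  fin_cases i <;> simp [Fin.sum_univ_two] <;> ring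

theorem driftOp_expBarrier (A : Plane → Matrix (Fin 2) (Fin 2) ℝ) (b : Plane → Plane)
    (l : ℝ) (e x : Plane) :
    driftOp A b (expBarrier l e) x =
      l * expBarrier l e x * (∑ i, b x i * e i - l * ∑ i, ∑ j, e i * A x i j * e j) := by
  have hd : DifferentiableAt ℝ (expBarrier l e) x :=
    ((contDiff_expBarrier l e).differentiable (by norm_num)).differentiableAt
  simp only [driftOp, partialD_expBarrier, Fin.sum_univ_two, partialD_const_mul _ _ hd]
  ring

theorem driftOp_expBarrier_neg {A : Plane → Matrix (Fin 2) (Fin 2) ℝ} {b : Plane → Plane}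
    {l c₀ : ℝ} {e x : Plane} (hl : 0 < l) (he : ‖e‖ = 1)
    (hA : ∀ ξ : Plane, c₀ * ‖ξ‖ ^ 2 ≤ ∑ i, ∑ j, ξ i * A x i j * ξ j) (hb : ‖b x‖ < c₀ * l) :
    driftOp A b (expBarrier l e) x < 0 := by
  rw [driftOp_expBarrier]
  refine mul_neg_of_pos_of_neg (mul_pos hl (expBarrier_pos _ _ _)) ?_
  have h1 : ∑ i, b x i * e i ≤ ‖b x‖ := by
    have := real_inner_le_norm e (b x)
    rw [he, one_mul, PiLp.inner_apply] at this
    simpa using this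
  have h2 := hA e
  rw [he] at h2
  nlinarith

theorem driftOp_add_const_mul {A : Plane → Matrix (Fin 2) (Fin 2) ℝ} {b : Plane → Plane}
    {u v : Plane → ℝ} {x : Plane} (hu : ContDiffAt ℝ 2 u x) (hv : ContDiffAt ℝ 2 v x) (c : ℝ) :
    driftOp A b (fun y => u y + c * v y) x = driftOp A b u x + c * driftOp A b v x := by
  have h1 : ∀ i {u v : Plane → ℝ} {y : Plane}, DifferentiableAt ℝ u y → DifferentiableAt ℝ v y →
      partialD i (fun y => u y + c * v y) y = partialD i u y + c * partialD i v y := by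
    intro i u v y hu hv
    simp [partialD, fderiv_fun_add hu (hv.const_mul c), fderiv_const_mul hv]
  have h2 : ∀ i j, partialD i (partialD j fun y => u y + c * v y) x
      = partialD i (partialD j u) x + c * partialD i (partialD j v) x := by
    intro i j
    rw [← h1 i (hu.differentiableAt_partialD j) (hv.differentiableAt_partialD j)]
    have : (partialD j fun y => u y + c * v y) =ᶠ[𝓝 x]
        fun y => partialD j u y + c * partialD j v y := by
      filter_upwards [hu.eventually_differentiableAt, hv.eventually_differentiableAt] with y h h'
        using h1 j h h'
    simp only [partialD] at this ⊢
    rw [this.fderiv_eq]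
  simp only [driftOp, h2, h1 _ (hu.differentiableAt (by norm_num))
    (hv.differentiableAt (by norm_num)),
    Fin.sum_univ_two]
  ring

/-! ### Topology of spiral sectors -/

theorem continuous_polarPt : Continuous fun p : ℝ × ℝ => polarPt p.1 p.2 := by
  unfold polarPt
  refine (PiLp.continuous_toLp 2 _).comp (continuous_pi fun i => ?_)
  fin_cases i <;> simp <;> fun_prop

theorem sum_polarPt_mul_polarPt (r θ s φ : ℝ) :
    ∑ i, polarPt r θ i * polarPt s φ i = r * s * Real.cos (θ - φ) := by
  simp [polarPt, Fin.sum_univ_two, Real.cos_sub]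
  ring

theorem norm_polarPt_one (θ : ℝ) : ‖polarPt 1 θ‖ = 1 := by
  simp [EuclideanSpace.norm_eq, polarPt, Fin.sum_univ_two]

/-- Near `X(r, θ)`, `r > 0`, the polar coordinates can be chosen near `(r, θ)`. -/
theorem exists_polar_coordinates_tendsto {r : ℝ} (hr : 0 < r) (θ : ℝ) :
    ∃ ρ φ : Plane → ℝ, Tendsto ρ (𝓝 (polarPt r θ)) (𝓝 r) ∧ Tendsto φ (𝓝 (polarPt r θ)) (𝓝 θ) ∧
      ∀ x, x = polarPt (ρ x) (φ x) := by
  -- Rotation by `-θ` sends the base point to the positive real axis, where `Complex.arg` is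
  -- continuous.
  let z : Plane → ℂ := fun x => (x 0 + x 1 * Complex.I) * Complex.exp (-θ * Complex.I)
  have hzc : Continuous z := by fun_prop
  have hexp : ∀ t : ℝ, Complex.exp (t * Complex.I) = Real.cos t + Real.sin t * Complex.I := by
    intro t; rw [Complex.exp_mul_I, Complex.ofReal_cos, Complex.ofReal_sin]
  have hz0 : z (polarPt r θ) = r := by
    have h1 : (((polarPt r θ) 0 : ℝ) : ℂ) + ((polarPt r θ) 1 : ℝ) * Complex.I
        = r * Complex.exp (θ * Complex.I) := by
      rw [hexp]; simp [polarPt]; ring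
    simp only [z]
    rw [h1, mul_assoc, ← Complex.exp_add]
    simp
  refine ⟨fun x => ‖z x‖, fun x => θ + (z x).arg, ?_, ?_, fun x => ?_⟩
  · have := hzc.norm.tendsto (polarPt r θ)
    rwa [hz0, Complex.norm_real, Real.norm_of_nonneg hr.le] at this
  · have h1 : ContinuousAt Complex.arg (z (polarPt r θ)) := by
      rw [hz0]; exact Complex.continuousAt_arg (Or.inl (by simpa using hr))
    have h2 := (h1.comp hzc.continuousAt).tendsto.const_add θ
    simp only [Function.comp_apply, hz0, Complex.arg_ofReal_of_nonneg hr.le, add_zero] at h2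
    exact h2
  · have h1 : ((x 0 : ℝ) : ℂ) + (x 1 : ℝ) * Complex.I
        = ‖z x‖ * Complex.exp ((θ + (z x).arg : ℝ) * Complex.I) := by
      rw [Complex.ofReal_add, add_mul, Complex.exp_add, mul_left_comm,
        Complex.norm_mul_exp_arg_mul_I]
      simp only [z]
      rw [mul_left_comm, ← Complex.exp_add]
      simp
    rw [hexp] at h1
    have hre := congrArg Complex.re h1
    have him := congrArg Complex.im h1
    simp [-Complex.ofReal_cos, -Complex.ofReal_sin, -Complex.ofReal_add] at hre him
    ext i
    fin_cases i
    · simpa [polarPt] using hre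
    · simpa [polarPt] using him

theorem isOpen_openSector {θ₀ : ℝ} {r₁ r₂ : ℝ → ℝ} {I : Set ℝ} (hI : IsOpen I)
    (hI₀ : I ⊆ Ici θ₀) (pos : ∀ θ, θ₀ ≤ θ → 0 < r₁ θ)
    (h₁ : ContinuousOn r₁ (Ici θ₀)) (h₂ : ContinuousOn r₂ (Ici θ₀)) :
    IsOpen (openSector r₁ r₂ I) := by
  rw [isOpen_iff_mem_nhds]
  rintro _ ⟨θ, hθ, r, hr₁, hr₂, rfl⟩
  obtain ⟨ρ, φ, hρ, hφ, hx⟩ :=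
    exists_polar_coordinates_tendsto ((pos θ (hI₀ hθ)).trans hr₁) θ
  have hc₁ : ContinuousAt r₁ θ :=
    h₁.continuousAt (mem_of_superset (hI.mem_nhds hθ) hI₀)
  have hc₂ : ContinuousAt r₂ θ :=
    h₂.continuousAt (mem_of_superset (hI.mem_nhds hθ) hI₀)
  filter_upwards [hφ.eventually (hI.mem_nhds hθ), (hc₁.tendsto.comp hφ).eventually_lt hρ hr₁,
    hρ.eventually_lt (hc₂.tendsto.comp hφ) hr₂] with x h h' h''
  exact ⟨φ x, h, ρ x, h', h'', hx x⟩

theorem isCompact_closedSector {r₁ r₂ : ℝ → ℝ} {I : Set ℝ} (hI : IsCompact I)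
    (h₁ : ContinuousOn r₁ I) (h₂ : ContinuousOn r₂ I) (hlt : ∀ θ ∈ I, r₁ θ < r₂ θ) :
    IsCompact (closedSector r₁ r₂ I) := by
  -- The sector is a continuous image of `[0, 1] × I`, the radius being interpolated linearly.
  let f : ℝ × ℝ → Plane := fun p => polarPt (r₁ p.2 + p.1 * (r₂ p.2 - r₁ p.2)) p.2
  have hf : ContinuousOn f (Icc (0 : ℝ) 1 ×ˢ I) := by
    have hs : MapsTo Prod.snd (Icc (0 : ℝ) 1 ×ˢ I) I := fun p hp => hp.2
    have c₁ : ContinuousOn (fun p : ℝ × ℝ => r₁ p.2) (Icc (0 : ℝ) 1 ×ˢ I) :=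
      h₁.comp continuousOn_snd hs
    have c₂ : ContinuousOn (fun p : ℝ × ℝ => r₂ p.2) (Icc (0 : ℝ) 1 ×ˢ I) :=
      h₂.comp continuousOn_snd hs
    exact continuous_polarPt.comp_continuousOn
      ((c₁.add (continuousOn_fst.mul (c₂.sub c₁))).prodMk continuousOn_snd)
  convert (isCompact_Icc.prod hI).image_of_continuousOn hf
  ext x
  constructor
  · rintro ⟨θ, hθ, r, hr₁, hr₂, rfl⟩
    have h := sub_pos.2 (hlt θ hθ)
    refine ⟨((r - r₁ θ) / (r₂ θ - r₁ θ), θ), ⟨⟨?_, ?_⟩, hθ⟩, ?_⟩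
    · exact div_nonneg (by linarith) h.le
    · exact (div_le_one h).2 (by linarith)
    · simp only [f]
      rw [div_mul_cancel₀ _ h.ne']
      congr 1
      ring
  · rintro ⟨⟨t, θ⟩, ⟨⟨ht₀, ht₁⟩, hθ⟩, rfl⟩
    have h := sub_pos.2 (hlt θ hθ)
    simp only at ht₀ ht₁ hθ
    exact ⟨θ, hθ, _, by simp only; nlinarith, by simp only; nlinarith, rfl⟩

theorem crossSection_subset_closedSector {r₁ r₂ : ℝ → ℝ} {I : Set ℝ} {θ : ℝ} (hθ : θ ∈ I) :
    crossSection r₁ r₂ θ ⊆ closedSector r₁ r₂ I := by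
  rintro x ⟨r, h₁, h₂, rfl⟩
  exact ⟨θ, hθ, r, h₁, h₂, rfl⟩

theorem closedSector_mono {r₁ r₂ : ℝ → ℝ} {I J : Set ℝ} (h : I ⊆ J) :
    closedSector r₁ r₂ I ⊆ closedSector r₁ r₂ J := by
  rintro x ⟨θ, hθ, hx⟩
  exact ⟨θ, h hθ, hx⟩

theorem openSector_mono {r₁ r₂ : ℝ → ℝ} {I J : Set ℝ} (h : I ⊆ J) :
    openSector r₁ r₂ I ⊆ openSector r₁ r₂ J := by
  rintro x ⟨θ, hθ, hx⟩
  exact ⟨θ, h hθ, hx⟩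

theorem openSector_subset_closedSector {r₁ r₂ : ℝ → ℝ} {I J : Set ℝ} (h : I ⊆ J) :
    openSector r₁ r₂ I ⊆ closedSector r₁ r₂ J := by
  rintro x ⟨θ, hθ, r, h₁, h₂, rfl⟩
  exact ⟨θ, h hθ, r, h₁.le, h₂.le, rfl⟩

theorem IsSpiralProfile.isCompact_closedSector_Icc {θ₀ rstar : ℝ} {r₁ r₂ : ℝ → ℝ}
    (hr : IsSpiralProfile θ₀ rstar r₁ r₂) {α β : ℝ} (hα : θ₀ ≤ α) :
    IsCompact (closedSector r₁ r₂ (Icc α β)) := by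
  have h : Icc α β ⊆ Ici θ₀ := fun θ hθ => hα.trans hθ.1
  exact isCompact_closedSector isCompact_Icc (hr.cont₁.mono h) (hr.cont₂.mono h)
    fun θ hθ => hr.lt θ (h hθ)

/-! ### Maxima over cross-sections -/

section SectionMax

variable {θ₀ rstar : ℝ} {r₁ r₂ : ℝ → ℝ} {u : Plane → ℝ} {θ : ℝ}

theorem sectionMax_nonneg (r₁ r₂ : ℝ → ℝ) (u : Plane → ℝ) (θ : ℝ) :
    0 ≤ sectionMax r₁ r₂ u θ := by
  refine Real.sSup_nonneg ?_
  rintro _ ⟨x, -, rfl⟩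
  exact le_max_left _ _

theorem le_sectionMax (hr : IsSpiralProfile θ₀ rstar r₁ r₂)
    (hu : ContinuousOn u (spiralClosed θ₀ r₁ r₂)) (hθ : θ₀ ≤ θ) {x : Plane}
    (hx : x ∈ crossSection r₁ r₂ θ) : u x ≤ sectionMax r₁ r₂ u θ := by
  have hK := hr.isCompact_closedSector_Icc (β := θ) hθ
  have hsub : closedSector r₁ r₂ (Icc θ θ) ⊆ spiralClosed θ₀ r₁ r₂ :=
    closedSector_mono fun φ hφ => hθ.trans hφ.1
  have hbdd := hK.bddAbove_image (f := fun x => max 0 (u x))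
    (continuousOn_const.sup (hu.mono hsub))
  refine (le_max_right 0 (u x)).trans (le_csSup (hbdd.mono (image_mono ?_)) ⟨x, hx, rfl⟩)
  exact crossSection_subset_closedSector (by simp)

theorem sectionMax_le {N : ℝ} (hN : 0 ≤ N) (h : ∀ x ∈ crossSection r₁ r₂ θ, u x ≤ N) :
    sectionMax r₁ r₂ u θ ≤ N := by
  refine Real.sSup_le ?_ hN
  rintro _ ⟨x, hx, rfl⟩
  exact max_le hN (h x hx)

end SectionMax

/-! ### Maximum principles -/

/-- A subsolution plus a positive multiple of a strict exponential subsolution attains its maximum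
over a closed sector on the boundary of that sector. -/
theorem exists_boundary_max_add_expBarrier {θ₀ rstar : ℝ} {r₁ r₂ : ℝ → ℝ}
    (hr : IsSpiralProfile θ₀ rstar r₁ r₂) {A : Plane → Matrix (Fin 2) (Fin 2) ℝ}
    {b : Plane → Plane} {c₀ l c α β : ℝ} {e : Plane} {u : Plane → ℝ}
    (hsymm : ∀ x ∈ spiralDomain θ₀ r₁ r₂, (A x).IsSymm) (hc₀ : 0 < c₀)
    (hell : ∀ x ∈ spiralDomain θ₀ r₁ r₂, ∀ ξ : Plane,
      c₀ * ‖ξ‖ ^ 2 ≤ ∑ i, ∑ j, ξ i * A x i j * ξ j)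
    (hα : θ₀ ≤ α) (hl : 0 < l) (he : ‖e‖ = 1) (hc : 0 < c)
    (hb : ∀ x ∈ openSector r₁ r₂ (Ioo α β), ‖b x‖ < c₀ * l)
    (hu : ContDiffOn ℝ 2 u (spiralDomain θ₀ r₁ r₂))
    (huc : ContinuousOn u (spiralClosed θ₀ r₁ r₂))
    (hL : ∀ x ∈ spiralDomain θ₀ r₁ r₂, driftOp A b u x ≤ 0)
    (hγ : ∀ x ∈ lateralBoundary θ₀ r₁ r₂, u x ≤ 0)
    {x : Plane} (hx : x ∈ closedSector r₁ r₂ (Icc α β)) :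
    ∃ y ∈ closedSector r₁ r₂ (Icc α β),
      u x + c * expBarrier l e x ≤ u y + c * expBarrier l e y ∧
      (u y ≤ 0 ∨ y ∈ crossSection r₁ r₂ α ∨ y ∈ crossSection r₁ r₂ β) := by
  have hsub : closedSector r₁ r₂ (Icc α β) ⊆ spiralClosed θ₀ r₁ r₂ :=
    closedSector_mono fun φ hφ => hα.trans hφ.1
  have hF := contDiff_expBarrier l e
  obtain ⟨y, hy, hmax⟩ := (hr.isCompact_closedSector_Icc hα).exists_isMaxOn ⟨x, hx⟩
    (f := fun y => u y + c * expBarrier l e y)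
    ((huc.mono hsub).add (hF.continuous.const_mul c).continuousOn)
  refine ⟨y, hy, hmax hx, ?_⟩
  by_contra! hne
  obtain ⟨hpos, hyα, hyβ⟩ := hne
  have hyU : y ∈ openSector r₁ r₂ (Ioo α β) := by
    obtain ⟨φ, hφ, r, h₁, h₂, rfl⟩ := hy
    have hφ₀ := hα.trans hφ.1
    refine ⟨φ, ⟨hφ.1.lt_of_ne ?_, hφ.2.lt_of_ne ?_⟩, r, h₁.lt_of_ne ?_, h₂.lt_of_ne ?_, rfl⟩
    · rintro rfl; exact hyα ⟨r, h₁, h₂, rfl⟩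
    · rintro rfl; exact hyβ ⟨r, h₁, h₂, rfl⟩
    · rintro rfl; exact hpos.not_ge (hγ _ (Or.inl ⟨φ, hφ₀, rfl⟩))
    · rintro rfl; exact hpos.not_ge (hγ _ (Or.inr ⟨φ, hφ₀, rfl⟩))
  have hI : Ioo α β ⊆ Ioi θ₀ := fun φ hφ => hα.trans_lt hφ.1
  have hyD : y ∈ spiralDomain θ₀ r₁ r₂ := openSector_mono hI hyU
  have hDopen : IsOpen (spiralDomain θ₀ r₁ r₂) :=
    isOpen_openSector isOpen_Ioi Ioi_subset_Ici_self hr.pos₁ hr.cont₁ hr.cont₂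
  have hSopen : IsOpen (openSector r₁ r₂ (Ioo α β)) :=
    isOpen_openSector isOpen_Ioo (hI.trans Ioi_subset_Ici_self) hr.pos₁ hr.cont₁ hr.cont₂
  have hloc : IsLocalMax (fun y => u y + c * expBarrier l e y) y :=
    hmax.isLocalMax (mem_of_superset (hSopen.mem_nhds hyU)
      (openSector_subset_closedSector Ioo_subset_Icc_self))
  have huy : ContDiffAt ℝ 2 u y := hu.contDiffAt (hDopen.mem_nhds hyD)
  -- At an interior maximum the operator is nonnegative on the sum, yet it is nonpositive on `u` and
  -- strictly negative on the barrier.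
  have hnn := driftOp_nonneg_of_isLocalMax (A := A) (b := b) (hsymm y hyD)
    (fun ξ => (by positivity : (0 : ℝ) ≤ c₀ * ‖ξ‖ ^ 2).trans (hell y hyD ξ))
    (huy.add (contDiffAt_const.mul hF.contDiffAt)) hloc
  rw [driftOp_add_const_mul huy hF.contDiffAt] at hnn
  have h1 := driftOp_expBarrier_neg hl he (hell y hyD) (hb y hyU)
  have h2 := hL y hyD
  nlinarith [mul_pos_of_neg_of_neg (neg_neg_of_pos hc) h1]

/-- The weak maximum principle on a sector on which the drift is bounded. -/
theorem sectionMax_le_max {θ₀ rstar : ℝ} {r₁ r₂ : ℝ → ℝ}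
    (hr : IsSpiralProfile θ₀ rstar r₁ r₂) {A : Plane → Matrix (Fin 2) (Fin 2) ℝ}
    {b : Plane → Plane} {c₀ B α β θ : ℝ} {u : Plane → ℝ}
    (hsymm : ∀ x ∈ spiralDomain θ₀ r₁ r₂, (A x).IsSymm) (hc₀ : 0 < c₀)
    (hell : ∀ x ∈ spiralDomain θ₀ r₁ r₂, ∀ ξ : Plane,
      c₀ * ‖ξ‖ ^ 2 ≤ ∑ i, ∑ j, ξ i * A x i j * ξ j)
    (hα : θ₀ ≤ α) (hθ : θ ∈ Icc α β)
    (hb : ∀ x ∈ openSector r₁ r₂ (Ioo α β), ‖b x‖ ≤ B)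
    (hu : ContDiffOn ℝ 2 u (spiralDomain θ₀ r₁ r₂))
    (huc : ContinuousOn u (spiralClosed θ₀ r₁ r₂))
    (hL : ∀ x ∈ spiralDomain θ₀ r₁ r₂, driftOp A b u x ≤ 0)
    (hγ : ∀ x ∈ lateralBoundary θ₀ r₁ r₂, u x ≤ 0) :
    sectionMax r₁ r₂ u θ ≤ max (sectionMax r₁ r₂ u α) (sectionMax r₁ r₂ u β) := by
  set l : ℝ := (|B| + 1) / c₀ with hl_def
  have hl : 0 < l := by positivity
  have hcl : B < c₀ * l := by
    rw [hl_def, mul_div_cancel₀ _ hc₀.ne']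
    linarith [le_abs_self B]
  set e := polarPt 1 0
  have hmaxnn := (sectionMax_nonneg r₁ r₂ u α).trans (le_max_left _ (sectionMax r₁ r₂ u β))
  obtain ⟨S, hS⟩ := (hr.isCompact_closedSector_Icc (β := β) hα).bddAbove_image
    (contDiff_expBarrier l e).continuous.continuousOn
  refine sectionMax_le hmaxnn fun x hx => le_of_forall_pos_le_add fun ε hε => ?_
  have hS0 : 0 < |S| + 1 := by positivity
  -- With this weight the barrier contributes at most `ε` on the compact sector; its direction is
  -- immaterial here.
  have hc : 0 < ε / (|S| + 1) := by positivity
  obtain ⟨y, hy, hxy, hy'⟩ := exists_boundary_max_add_expBarrier hr hsymm hc₀ hell hα hl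
    (norm_polarPt_one 0) hc (fun x hx => (hb x hx).trans_lt hcl) hu huc hL hγ
    (crossSection_subset_closedSector hθ hx)
  have h1 : u y ≤ max (sectionMax r₁ r₂ u α) (sectionMax r₁ r₂ u β) := by
    rcases hy' with h | h | h
    · exact h.trans hmaxnn
    · exact (le_sectionMax hr huc hα h).trans (le_max_left _ _)
    · exact (le_sectionMax hr huc (hα.trans (hθ.1.trans hθ.2)) h).trans (le_max_right _ _)
  have h2 : ε / (|S| + 1) * expBarrier l e y ≤ ε := by
    have : expBarrier l e y ≤ |S| + 1 := by
      linarith [hS ⟨y, hy, rfl⟩, le_abs_self S]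
    calc _ ≤ ε / (|S| + 1) * (|S| + 1) := by gcongr
      _ = ε := div_mul_cancel₀ _ hS0.ne'
  have h3 := mul_pos hc (expBarrier_pos l e x)
  linarith

/-- In a thin sector the maximum over a cross-section is smaller, by a definite factor, than the
maxima over the two cross-sections at angular distance one. -/
theorem sectionMax_le_mul_max {θ₀ rstar : ℝ} {r₁ r₂ : ℝ → ℝ}
    (hr : IsSpiralProfile θ₀ rstar r₁ r₂) {A : Plane → Matrix (Fin 2) (Fin 2) ℝ}
    {b : Plane → Plane} {c₀ l δ θ : ℝ} {u : Plane → ℝ}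
    (hsymm : ∀ x ∈ spiralDomain θ₀ r₁ r₂, (A x).IsSymm) (hc₀ : 0 < c₀)
    (hell : ∀ x ∈ spiralDomain θ₀ r₁ r₂, ∀ ξ : Plane,
      c₀ * ‖ξ‖ ^ 2 ≤ ∑ i, ∑ j, ξ i * A x i j * ξ j)
    (hθ : θ₀ ≤ θ - 1) (hl : 0 < l) (hδ : 0 ≤ δ)
    (hr₁ : ∀ φ, θ - 1 ≤ φ → rstar - δ ≤ r₁ φ) (hr₂ : ∀ φ, θ - 1 ≤ φ → r₂ φ ≤ rstar + δ)
    (hb : ∀ x ∈ openSector r₁ r₂ (Ioo (θ - 1) (θ + 1)), ‖b x‖ < c₀ * l)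
    (hu : ContDiffOn ℝ 2 u (spiralDomain θ₀ r₁ r₂))
    (huc : ContinuousOn u (spiralClosed θ₀ r₁ r₂))
    (hL : ∀ x ∈ spiralDomain θ₀ r₁ r₂, driftOp A b u x ≤ 0)
    (hγ : ∀ x ∈ lateralBoundary θ₀ r₁ r₂, u x ≤ 0) :
    sectionMax r₁ r₂ u θ ≤
      (1 - (Real.exp (-(2 * l * δ)) - Real.exp (-(l * (rstar + δ) * (1 - Real.cos 1))))) *
        max (sectionMax r₁ r₂ u (θ - 1)) (sectionMax r₁ r₂ u (θ + 1)) := by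
  set N := max (sectionMax r₁ r₂ u (θ - 1)) (sectionMax r₁ r₂ u (θ + 1))
  set E₁ := Real.exp (-(2 * l * δ))
  set E₂ := Real.exp (-(l * (rstar + δ) * (1 - Real.cos 1)))
  have hN : 0 ≤ N := (sectionMax_nonneg r₁ r₂ u (θ - 1)).trans (le_max_left _ _)
  have hE₁ : E₁ ≤ 1 := Real.exp_le_one_iff.2 (by have := mul_nonneg hl.le hδ; linarith)
  have hE₂ : 0 < E₂ := Real.exp_pos _
  have hR : 0 < rstar + δ := by linarith [hr.rstar_pos]
  have hfactor : 0 ≤ 1 - (E₁ - E₂) := by linarith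
  refine sectionMax_le (mul_nonneg hfactor hN) fun x hx => ?_
  -- The barrier needs a positive weight, but `N` may be zero; hence `K > N`, followed by `K → N`.
  suffices h : ∀ K : ℝ, N < K → u x ≤ (1 - (E₁ - E₂)) * K by
    refine ge_of_tendsto (x := 𝓝[>] N) (f := fun K => (1 - (E₁ - E₂)) * K) ?_
      (eventually_nhdsWithin_of_forall h)
    exact ((continuous_const.mul continuous_id).tendsto N).mono_left nhdsWithin_le_nhds
  intro K hK
  have hK0 : 0 < K := hN.trans_lt hK
  set e := polarPt 1 θ
  have hF : ∀ r φ, expBarrier l e (polarPt r φ) = Real.exp (l * (r * Real.cos (φ - θ))) := by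
    intro r φ
    rw [expBarrier, sum_polarPt_mul_polarPt, mul_one]
  -- `G` dominates the barrier on the whole sector, so the weighted barrier is at most `K` there.
  set G := Real.exp (l * (rstar + δ)) with hG_def
  have hG : 0 < G := Real.exp_pos _
  have hc : 0 < K / G := by positivity
  obtain ⟨y, hy, hxy, hy'⟩ := exists_boundary_max_add_expBarrier hr hsymm hc₀ hell hθ hl
    (norm_polarPt_one θ) hc hb hu huc hL hγ
    (crossSection_subset_closedSector (θ := θ) (by constructor <;> linarith) hx)
  have hFx : K * E₁ ≤ K / G * expBarrier l e x := by
    obtain ⟨r, h₁, h₂, rfl⟩ := hx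
    rw [hF, sub_self, Real.cos_zero, mul_one, div_mul_eq_mul_div, mul_div_assoc, hG_def,
      ← Real.exp_sub]
    refine mul_le_mul_of_nonneg_left (Real.exp_le_exp.2 ?_) hK0.le
    nlinarith [hr₁ θ (by linarith)]
  have hFy : K / G * expBarrier l e y ≤ K := by
    obtain ⟨φ, hφ, r, h₁, h₂, rfl⟩ := hy
    have hr0 := (hr.pos₁ φ (hθ.trans hφ.1)).trans_le h₁
    have : expBarrier l e (polarPt r φ) ≤ G := by
      rw [hF]
      refine Real.exp_le_exp.2 (mul_le_mul_of_nonneg_left ?_ hl.le)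
      nlinarith [Real.cos_le_one (φ - θ), hr₂ φ hφ.1]
    calc _ ≤ K / G * G := by gcongr
      _ = K := div_mul_cancel₀ _ hG.ne'
  have hends : ∀ φ, θ - 1 ≤ φ → Real.cos (φ - θ) = Real.cos 1 → y ∈ crossSection r₁ r₂ φ →
      K / G * expBarrier l e y ≤ K * E₂ := by
    rintro φ hφ hcos ⟨r, h₁, h₂, rfl⟩
    rw [hF, hcos, div_mul_eq_mul_div, mul_div_assoc, hG_def, ← Real.exp_sub]
    refine mul_le_mul_of_nonneg_left (Real.exp_le_exp.2 ?_) hK0.le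
    have := mul_le_mul_of_nonneg_left (mul_le_mul_of_nonneg_right (h₂.trans (hr₂ φ hφ))
      Real.cos_one_pos.le) hl.le
    linarith
  have hKE := mul_pos hK0 hE₂
  -- In every case the sum at `y` is at most `K + K * E₂`: at most `K` where `u y ≤ 0`, at most `N +
  -- K * E₂` on the end sections. At `x` it is at least `u x + K * E₁`.
  rcases hy' with h | h | h
  · linarith
  · have h1 := hends (θ - 1) le_rfl (by rw [sub_sub_cancel_left, Real.cos_neg]) h
    have h2 := (le_sectionMax hr huc hθ h).trans (le_max_left _ (sectionMax r₁ r₂ u (θ + 1)))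
    linarith
  · have h1 := hends (θ + 1) (by linarith) (by rw [add_sub_cancel_left]) h
    have h2 := (le_sectionMax hr huc (by linarith) h).trans
      (le_max_right (sectionMax r₁ r₂ u (θ - 1)) _)
    linarith

/-! ### A growth dichotomy for quasiconvex functions -/

/-- After one strict increase from `α` to `β`, the maximum of the end values is always the
right-hand one. The inequality `M α < M β` is retained because it yields `0 < M β` when `M` is
nonnegative. -/
theorem antitoneOn_or_eventually_monotoneOn {M : ℝ → ℝ} {θ₀ : ℝ}
    (hM : ∀ α β θ, θ₀ ≤ α → θ ∈ Icc α β → M θ ≤ max (M α) (M β)) :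
    AntitoneOn M (Ici θ₀) ∨
      ∃ α β, θ₀ ≤ β ∧ M α < M β ∧ MonotoneOn M (Ici β) := by
  by_cases hanti : AntitoneOn M (Ici θ₀)
  · exact Or.inl hanti
  right
  simp only [AntitoneOn, not_forall, not_le] at hanti
  obtain ⟨α, hα, β, hβ, hαβ, hlt⟩ := hanti
  refine ⟨α, β, hβ, hlt, ?_⟩
  have hle : ∀ θ, β ≤ θ → M β ≤ M θ := fun θ hθ =>
    (le_max_iff.1 (hM α θ β hα ⟨hαβ, hθ⟩)).resolve_left hlt.not_ge
  intro θ hθ φ _ hφ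
  exact (le_max_iff.1 (hM α φ θ hα ⟨hαβ.trans hθ, hφ⟩)).resolve_left
    (hlt.trans_le (hle θ hθ)).not_ge

section Dichotomy

variable {M g : ℝ → ℝ} {a : ℝ}

theorem AntitoneOn.intervalIntegrable_of_le (hg : AntitoneOn g (Ici a)) {s t : ℝ} (hs : a ≤ s)
    (ht : a ≤ t) : IntervalIntegrable g volume s t :=
  (hg.mono fun _ hx => (le_min hs ht).trans hx.1).intervalIntegrable

theorem AntitoneOn.intervalIntegral_le_mul (hg : AntitoneOn g (Ici a)) {s t : ℝ} (hs : a ≤ s)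
    (hst : s ≤ t) : ∫ ζ in s..t, g ζ ≤ (t - s) * g s := by
  have := intervalIntegral.integral_mono_on hst (hg.intervalIntegrable_of_le hs (hs.trans hst))
    (intervalIntegrable_const (c := g s)) fun x hx => hg hs (hs.trans hx.1) hx.1
  simpa using this

/-- For decreasing `M` the step inequality reads `M θ ≤ M (θ - 1) ≤ (1 - g θ / 2) * M (θ - 2)`,
which is iterated over windows of length 2. -/
theorem decay_of_antitoneOn (hg : AntitoneOn g (Ici a)) (hg0 : ∀ θ, a ≤ θ → 0 ≤ g θ)
    (hM0 : ∀ θ, 0 ≤ M θ) (hanti : AntitoneOn M (Ici a))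
    (hstep : ∀ θ, a + 1 ≤ θ → M θ ≤ (1 - g (θ + 1) / 2) * max (M (θ - 1)) (M (θ + 1)))
    {θ : ℝ} (hθ : a ≤ θ) :
    M θ ≤ M a * Real.exp (-(1 / 4) * ∫ ζ in (a + 4)..(θ + 2), g ζ) := by
  have key : ∀ k : ℕ, ∀ θ, a ≤ θ → θ ≤ a + 2 * (k + 1) →
      M θ ≤ M a * Real.exp (-(1 / 4) * ∫ ζ in (a + 4)..(θ + 2), g ζ) := by
    intro k
    induction k with
    -- In the base window the integral runs backwards, so the exponential is at least 1; this fixes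
    -- the lower limit `a + 4`.
    | zero =>
      intro θ h₁ h₂
      simp only [Nat.cast_zero, zero_add, mul_one] at h₂
      refine (hanti self_mem_Ici h₁ h₁).trans (le_mul_of_one_le_right (hM0 a) ?_)
      rw [Real.one_le_exp_iff, intervalIntegral.integral_symm]
      have := intervalIntegral.integral_nonneg (f := g) (μ := volume)
        (show θ + 2 ≤ a + 4 by linarith) fun x hx => hg0 x (by linarith [hx.1])
      linarith
    | succ k ih =>
      intro θ h₁ h₂
      rcases le_total θ (a + 2 * (k + 1)) with h | h
      · exact ih θ h₁ h
      have hk : (0 : ℝ) ≤ k := k.cast_nonneg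
      push_cast at h₂
      have hprev := ih (θ - 2) (by linarith) (by linarith)
      rw [sub_add_cancel] at hprev
      have h1 := hstep (θ - 1) (by linarith)
      rw [sub_add_cancel, sub_sub, one_add_one_eq_two,
        max_eq_left (hanti (show a ≤ θ - 2 by linarith) h₁ (by linarith))] at h1
      have h1' : M θ ≤ (1 - g θ / 2) * M (θ - 2) :=
        (hanti (show a ≤ θ - 1 by linarith) h₁ (by linarith)).trans h1
      -- As `g` decreases, its integral over a window of length 2 is at most `2 * g θ`; hence the
      -- rate `1 / 4`.
      have h2 : 1 - g θ / 2 ≤ Real.exp (-(1 / 4) * ∫ ζ in θ..(θ + 2), g ζ) := by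
        have h3 := hg.intervalIntegral_le_mul h₁ (show θ ≤ θ + 2 by linarith)
        have h4 := Real.add_one_le_exp (-(g θ / 2))
        refine le_trans (by linarith) (h4.trans (Real.exp_le_exp.2 (by linarith)))
      rw [← intervalIntegral.integral_add_adjacent_intervals
        (hg.intervalIntegrable_of_le (show a ≤ a + 4 by linarith) h₁)
        (hg.intervalIntegrable_of_le h₁ (show a ≤ θ + 2 by linarith)), mul_add, Real.exp_add]
      calc M θ ≤ (1 - g θ / 2) * M (θ - 2) := h1'
        _ ≤ Real.exp (-(1 / 4) * ∫ ζ in θ..(θ + 2), g ζ) *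
            (M a * Real.exp (-(1 / 4) * ∫ ζ in (a + 4)..θ, g ζ)) :=
          mul_le_mul h2 hprev (hM0 _) (Real.exp_pos _).le
        _ = _ := by ring
  obtain ⟨k, hk⟩ := exists_nat_ge ((θ - a) / 2)
  exact key k θ hθ (by linarith)

/-- For increasing `M` the right-hand neighbour is the larger, so `M (θ - 1) ≤ (1 - g θ / 2) * M θ`,
iterated over windows of length 1. -/
theorem growth_of_monotoneOn {β : ℝ} (hg : AntitoneOn g (Ici a)) (hg0 : ∀ θ, a ≤ θ → 0 ≤ g θ)
    (hg1 : ∀ θ, a ≤ θ → g θ ≤ 1)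
    (hβ : a + 1 ≤ β) (hMβ : 0 < M β) (hmono : MonotoneOn M (Ici β))
    (hstep : ∀ θ, a + 1 ≤ θ → M θ ≤ (1 - g (θ + 1) / 2) * max (M (θ - 1)) (M (θ + 1)))
    {θ : ℝ} (hθ : β + 1 ≤ θ) :
    M β * Real.exp (1 / 4 * ∫ ζ in (β + 3)..(θ + 1), g ζ) ≤ M θ := by
  have key : ∀ k : ℕ, ∀ θ, β + 1 ≤ θ → θ ≤ β + 2 + k →
      M β * Real.exp (1 / 4 * ∫ ζ in (β + 3)..(θ + 1), g ζ) ≤ M θ := by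
    intro k
    induction k with
    | zero =>
      intro θ h₁ h₂
      simp only [Nat.cast_zero, add_zero] at h₂
      refine le_trans (mul_le_of_le_one_right hMβ.le ?_)
        (hmono self_mem_Ici (show β ≤ θ by linarith) (show β ≤ θ by linarith))
      rw [Real.exp_le_one_iff, intervalIntegral.integral_symm]
      have := intervalIntegral.integral_nonneg (f := g) (μ := volume)
        (show θ + 1 ≤ β + 3 by linarith) fun x hx => hg0 x (by linarith [hx.1])
      linarith
    | succ k ih =>
      intro θ h₁ h₂
      rcases le_total θ (β + 2 + k) with h | h
      · exact ih θ h₁ h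
      have hk : (0 : ℝ) ≤ k := k.cast_nonneg
      push_cast at h₂
      have haθ : a ≤ θ := by linarith
      have hprev := ih (θ - 1) (by linarith) (by linarith)
      rw [sub_add_cancel] at hprev
      have h1 := hstep (θ - 1) (by linarith)
      rw [sub_add_cancel, sub_sub, one_add_one_eq_two,
        max_eq_right (hmono (show β ≤ θ - 2 by linarith) (show β ≤ θ by linarith)
          (by linarith))] at h1
      have hMθ : 0 ≤ M θ := hMβ.le.trans
        (hmono self_mem_Ici (show β ≤ θ by linarith) (show β ≤ θ by linarith))
      have h2 : Real.exp (1 / 4 * ∫ ζ in θ..(θ + 1), g ζ) * (1 - g θ / 2) ≤ 1 := by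
        have h3 := hg.intervalIntegral_le_mul haθ (show θ ≤ θ + 1 by linarith)
        have h4 := Real.add_one_le_exp (-(g θ / 2))
        have h5 := hg0 θ haθ
        calc _ ≤ Real.exp (g θ / 2) * Real.exp (-(g θ / 2)) :=
              mul_le_mul (Real.exp_le_exp.2 (by linarith)) (by linarith)
                (by linarith [hg1 θ haθ]) (Real.exp_pos _).le
          _ = 1 := by rw [← Real.exp_add, add_neg_cancel, Real.exp_zero]
      rw [← intervalIntegral.integral_add_adjacent_intervals
        (hg.intervalIntegrable_of_le (show a ≤ β + 3 by linarith) haθ)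
        (hg.intervalIntegrable_of_le haθ (show a ≤ θ + 1 by linarith)), mul_add, Real.exp_add]
      set X := Real.exp (1 / 4 * ∫ ζ in θ..(θ + 1), g ζ)
      have hX : 0 < X := Real.exp_pos _
      calc M β * (Real.exp (1 / 4 * ∫ ζ in (β + 3)..θ, g ζ) * X)
          = (M β * Real.exp (1 / 4 * ∫ ζ in (β + 3)..θ, g ζ)) * X := by ring
        _ ≤ ((1 - g θ / 2) * M θ) * X := mul_le_mul_of_nonneg_right (hprev.trans h1) hX.le
        _ = (X * (1 - g θ / 2)) * M θ := by ring
        _ ≤ 1 * M θ := mul_le_mul_of_nonneg_right h2 hMθ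
        _ = M θ := one_mul _
  obtain ⟨k, hk⟩ := exists_nat_ge (θ - β)
  exact key k θ hθ (by linarith)

end Dichotomy

/-! ### Contraction under the drift growth condition, and the main dichotomy -/

/-- Drift bounds on bounded sectors. -/
theorem IsAdmissibleDrift.exists_bound {θ₀ Θbar κ : ℝ} {r₁ r₂ m : ℝ → ℝ} {b : Plane → Plane}
    (hb : IsAdmissibleDrift θ₀ r₁ r₂ b Θbar m κ) {α β : ℝ} (hα : θ₀ ≤ α) :
    ∃ B, ∀ x ∈ openSector r₁ r₂ (Ioo α β), ‖b x‖ ≤ B := by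
  obtain ⟨B, hB⟩ := hb.bdd
  refine ⟨max B (m β), fun x hx => ?_⟩
  have hxD : x ∈ spiralDomain θ₀ r₁ r₂ := openSector_mono (fun φ hφ => hα.trans_lt hφ.1) hx
  obtain ⟨φ, hφ, r, h₁, h₂, rfl⟩ := hx
  rcases le_total φ Θbar with h | h
  · exact (hB _ ⟨hxD, φ, ⟨hα.trans hφ.1.le, h⟩, r, h₁, h₂, rfl⟩).trans (le_max_left _ _)
  · exact ((hb.le_m φ h _ ⟨hxD, r, h₁.le, h₂.le, rfl⟩).trans
      (hb.mono h (h.trans hφ.2.le) hφ.2.le)).trans (le_max_right _ _)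

/-- Beyond some angle, the maximum over a cross-section is smaller than the maxima over
neighbouring cross-sections by the factor `1 - κ ^ m / 2`. -/
theorem exists_sectionMax_contraction {θ₀ rstar : ℝ} {r₁ r₂ : ℝ → ℝ}
    (hr : IsSpiralProfile θ₀ rstar r₁ r₂) {A : Plane → Matrix (Fin 2) (Fin 2) ℝ}
    (hA : IsUniformlyElliptic A (spiralDomain θ₀ r₁ r₂))
    {b : Plane → Plane} {Θbar : ℝ} {m : ℝ → ℝ} {κ : ℝ}
    (hb : IsAdmissibleDrift θ₀ r₁ r₂ b Θbar m κ) :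
    ∃ a, Θbar ≤ a ∧ ∀ u : Plane → ℝ,
      ContDiffOn ℝ 2 u (spiralDomain θ₀ r₁ r₂) →
      ContinuousOn u (spiralClosed θ₀ r₁ r₂) →
      (∀ x ∈ spiralDomain θ₀ r₁ r₂, driftOp A b u x ≤ 0) →
      (∀ x ∈ lateralBoundary θ₀ r₁ r₂, u x ≤ 0) →
      ∀ θ, a + 1 ≤ θ → sectionMax r₁ r₂ u θ ≤ (1 - κ ^ m (θ + 1) / 2) *
        max (sectionMax r₁ r₂ u (θ - 1)) (sectionMax r₁ r₂ u (θ + 1)) := by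
  obtain ⟨hsymm, ⟨c₀, hc₀, hell⟩, -⟩ := hA
  have hrs := hr.rstar_pos
  have hlogκ : 0 < -Real.log κ := neg_pos.2 (Real.log_neg hb.κ_pos hb.κ_lt_one)
  have hcos : 0 < 1 - Real.cos 1 := by
    have := Real.cos_lt_cos_of_nonneg_of_le_pi le_rfl
      (by linarith [Real.pi_gt_three] : (1 : ℝ) ≤ Real.pi) one_pos
    rw [Real.cos_zero] at this
    linarith
  -- With `l = 2μ/c₀`, the first bound will give `κ ^ μ ≤ E₁` and the second `E₂ ≤ E₁²`.
  obtain ⟨δ, hδ, hδκ, hδr⟩ : ∃ δ, 0 < δ ∧ 4 * δ ≤ c₀ * -Real.log κ ∧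
      4 * δ ≤ rstar * (1 - Real.cos 1) := by
    refine ⟨min (c₀ * -Real.log κ) (rstar * (1 - Real.cos 1)) / 4, by positivity, ?_, ?_⟩
    · linarith [min_le_left (c₀ * -Real.log κ) (rstar * (1 - Real.cos 1))]
    · linarith [min_le_right (c₀ * -Real.log κ) (rstar * (1 - Real.cos 1))]
  -- The lower bound on `m` ensures `2lδ ≥ log 2`, that is `E₁ ≤ 1 / 2`.
  obtain ⟨a, ha⟩ := eventually_atTop.1 ((hr.lim₁.eventually
    (eventually_ge_nhds <| show rstar - δ < rstar by linarith)).and ((hr.lim₂.eventually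
    (eventually_le_nhds <| show rstar < rstar + δ by linarith)).and ((hb.lim.eventually_ge_atTop
      (c₀ * Real.log 2 / (4 * δ))).and (eventually_ge_atTop Θbar))))
  have haΘ : Θbar ≤ a := (ha a le_rfl).2.2.2
  refine ⟨a, haΘ, fun u hu huc hL hγ θ hθ => ?_⟩
  have hθ₀ : θ₀ ≤ θ - 1 := hb.le_Θbar.trans (by linarith)
  set μ := m (θ + 1) with hμ_def
  have hμ : c₀ * Real.log 2 / (4 * δ) ≤ μ := (ha (θ + 1) (by linarith)).2.2.1
  have hlog2 : 0 < Real.log 2 := Real.log_pos one_lt_two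
  have hμ0 : 0 < μ := lt_of_lt_of_le (by positivity) hμ
  -- By monotonicity `μ = m (θ + 1)` bounds the drift on the whole sector; the factor 2 makes `‖b x‖
  -- < c₀ * l` strict.
  set l := 2 * μ / c₀ with hl_def
  have hl : 0 < l := by positivity
  have hcl : c₀ * l = 2 * μ := mul_div_cancel₀ _ hc₀.ne'
  have key := sectionMax_le_mul_max hr hsymm hc₀ hell hθ₀ hl hδ.le
    (fun φ hφ => (ha φ (by linarith)).1) (fun φ hφ => (ha φ (by linarith)).2.1)
    (fun x hx => by
      have hxD : x ∈ spiralDomain θ₀ r₁ r₂ := openSector_mono (fun φ hφ => hθ₀.trans_lt hφ.1) hx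
      obtain ⟨φ, hφ, r, h₁, h₂, rfl⟩ := hx
      have hφΘ : Θbar ≤ φ := by linarith [hφ.1]
      have h1 := (hb.le_m φ hφΘ _ ⟨hxD, r, h₁.le, h₂.le, rfl⟩).trans
        (hb.mono hφΘ (hφΘ.trans hφ.2.le) hφ.2.le)
      rw [hcl]
      linarith) hu huc hL hγ
  refine key.trans (mul_le_mul_of_nonneg_right ?_
    ((sectionMax_nonneg r₁ r₂ u (θ - 1)).trans (le_max_left _ _)))
  have hlδ : Real.log 2 ≤ 2 * l * δ := by
    rw [div_le_iff₀ (by positivity), ← mul_assoc] at hμ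
    have : c₀ * Real.log 2 ≤ c₀ * (2 * l * δ) := by nlinarith
    exact le_of_mul_le_mul_left this hc₀
  have hE : Real.exp (-(2 * l * δ)) ≤ 1 / 2 := by
    calc _ ≤ Real.exp (-Real.log 2) := Real.exp_le_exp.2 (by linarith)
      _ = 1 / 2 := by rw [Real.exp_neg, Real.exp_log two_pos, one_div]
  have hκE : κ ^ μ ≤ Real.exp (-(2 * l * δ)) := by
    rw [Real.rpow_def_of_pos hb.κ_pos]
    refine Real.exp_le_exp.2 ?_
    have : c₀ * (2 * l * δ) ≤ c₀ * (μ * -Real.log κ) := by nlinarith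
    have := le_of_mul_le_mul_left this hc₀
    linarith
  have hE' : Real.exp (-(l * (rstar + δ) * (1 - Real.cos 1))) ≤
      Real.exp (-(2 * l * δ)) * Real.exp (-(2 * l * δ)) := by
    rw [← Real.exp_add]
    refine Real.exp_le_exp.2 ?_
    have h1 : l * (4 * δ) ≤ l * ((rstar + δ) * (1 - Real.cos 1)) :=
      mul_le_mul_of_nonneg_left (by nlinarith) hl.le
    linarith
  -- `E₁ - E₂ ≥ E₁ - E₁² ≥ E₁ / 2 ≥ κ ^ μ / 2`.
  nlinarith [Real.exp_pos (-(2 * l * δ))]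

theorem theorem4p4 (θ₀ rstar : ℝ) (r₁ r₂ : ℝ → ℝ) (hr : IsSpiralProfile θ₀ rstar r₁ r₂)
    (A : Plane → Matrix (Fin 2) (Fin 2) ℝ)
    (hA : IsUniformlyElliptic A (spiralDomain θ₀ r₁ r₂))
    (b : Plane → Plane) (Θbar : ℝ) (m : ℝ → ℝ) (κ : ℝ)
    (hb : IsAdmissibleDrift θ₀ r₁ r₂ b Θbar m κ) :
    ∃ Θ₀ νbar : ℝ, Θbar ≤ Θ₀ ∧ 0 < νbar ∧
      ∀ u : Plane → ℝ,
        ContDiffOn ℝ 2 u (spiralDomain θ₀ r₁ r₂) →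
        ContinuousOn u (spiralClosed θ₀ r₁ r₂) →
        (∀ x ∈ spiralDomain θ₀ r₁ r₂, driftOp A b u x ≤ 0) →
        (∀ x ∈ lateralBoundary θ₀ r₁ r₂, u x ≤ 0) →
        ((∀ θ, θ₀ ≤ θ →
            sectionMax r₁ r₂ u θ ≤ sectionMax r₁ r₂ u θ₀ *
              min 1 (Real.exp (-νbar * ∫ ζ in Θ₀..θ, κ ^ m ζ))) ∧
          Tendsto (sectionMax r₁ r₂ u) atTop (𝓝 0)) ∨
        ((∃ C : ℝ, 0 < C ∧ ∀ᶠ θ in atTop,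
            C * Real.exp (νbar * ∫ ζ in Θbar..θ, κ ^ m ζ) ≤ sectionMax r₁ r₂ u θ) ∧
          Tendsto (sectionMax r₁ r₂ u) atTop atTop) := by
  obtain ⟨a, haΘ, hstep⟩ := exists_sectionMax_contraction hr hA hb
  obtain ⟨hsymm, ⟨c₀, hc₀, hell⟩, -⟩ := hA
  refine ⟨a + 4, 1 / 4, by linarith, by norm_num, fun u hu huc hL hγ => ?_⟩
  have hstep := hstep u hu huc hL hγ
  set M := sectionMax r₁ r₂ u
  have hM0 : ∀ θ, 0 ≤ M θ := sectionMax_nonneg r₁ r₂ u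
  have hgpos : ∀ θ, 0 < κ ^ m θ := fun θ => Real.rpow_pos_of_pos hb.κ_pos _
  have hgΘ : AntitoneOn (fun θ => κ ^ m θ) (Ici Θbar) := fun s hs t ht hst =>
    Real.rpow_le_rpow_of_exponent_ge hb.κ_pos hb.κ_lt_one.le (hb.mono hs ht hst)
  have hg : AntitoneOn (fun θ => κ ^ m θ) (Ici a) := hgΘ.mono (Ici_subset_Ici.2 haΘ)
  have haθ₀ : θ₀ ≤ a := hb.le_Θbar.trans haΘ
  have hdiv : ∀ s, Θbar ≤ s → Tendsto (fun T => ∫ ζ in s..T, κ ^ m ζ) atTop atTop := by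
    intro s hs
    refine (tendsto_atTop_add_const_left _ (-∫ ζ in Θbar..s, κ ^ m ζ) hb.diverges).congr' ?_
    filter_upwards [eventually_ge_atTop Θbar] with T hT
    rw [← intervalIntegral.integral_add_adjacent_intervals
      (hgΘ.intervalIntegrable_of_le le_rfl hs) (hgΘ.intervalIntegrable_of_le hs hT)]
    ring
  rcases antitoneOn_or_eventually_monotoneOn (M := M) (θ₀ := θ₀) (fun α β θ hα hθ => by
    obtain ⟨B, hB⟩ := hb.exists_bound (β := β) hα
    exact sectionMax_le_max hr hsymm hc₀ hell hα hθ hB hu huc hL hγ)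
    with hanti | ⟨α, β, hβ, hlt, hmono⟩
  · left
    have hdecay : ∀ θ, a + 4 ≤ θ →
        M θ ≤ M θ₀ * Real.exp (-(1 / 4) * ∫ ζ in (a + 4)..θ, κ ^ m ζ) := by
      intro θ hθ
      refine (decay_of_antitoneOn hg (fun θ _ => (hgpos θ).le) hM0
        (hanti.mono (Ici_subset_Ici.2 haθ₀)) hstep (by linarith)).trans
        (mul_le_mul (hanti self_mem_Ici haθ₀ haθ₀) (Real.exp_le_exp.2 ?_) (Real.exp_pos _).le
          (hM0 _))
      have h1 := intervalIntegral.integral_add_adjacent_intervals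
        (hg.intervalIntegrable_of_le (show a ≤ a + 4 by linarith) (show a ≤ θ by linarith))
        (hg.intervalIntegrable_of_le (show a ≤ θ by linarith) (show a ≤ θ + 2 by linarith))
      have h2 := intervalIntegral.integral_nonneg (μ := volume) (f := fun ζ => κ ^ m ζ)
        (show θ ≤ θ + 2 by linarith) fun x _ => (hgpos x).le
      linarith
    refine ⟨fun θ hθ => ?_, ?_⟩
    · rw [mul_min_of_nonneg _ _ (hM0 _), mul_one]
      have h0 : M θ ≤ M θ₀ := hanti self_mem_Ici hθ hθ
      refine le_min h0 ?_
      rcases le_total (a + 4) θ with h | h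
      · exact hdecay θ h
      -- Below `a + 4` the reversed integral is nonpositive even where `m` is uncontrolled: `κ ^ m`
      -- is positive everywhere, and a nonintegrable integrand has integral 0.
      · refine h0.trans (le_mul_of_one_le_right (hM0 _) ?_)
        rw [Real.one_le_exp_iff, intervalIntegral.integral_symm]
        have := intervalIntegral.integral_nonneg (μ := volume) (f := fun ζ => κ ^ m ζ)
          h fun x _ => (hgpos x).le
        linarith
    · have h1 : Tendsto (fun θ => M θ₀ * Real.exp (-(1 / 4) * ∫ ζ in (a + 4)..θ, κ ^ m ζ))
          atTop (𝓝 (M θ₀ * 0)) :=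
        (Real.tendsto_exp_atBot.comp ((hdiv (a + 4) (by linarith)).const_mul_atTop_of_neg
          (by norm_num))).const_mul _
      rw [mul_zero] at h1
      refine squeeze_zero' (Eventually.of_forall hM0) ?_ h1
      filter_upwards [eventually_ge_atTop (a + 4)] with θ hθ using hdecay θ hθ
  · right
    -- Past `β'` both the monotonicity and the step inequality are available.
    set β' := max β (a + 1)
    have hβ' : a + 1 ≤ β' := le_max_right _ _
    have hMβ : 0 < M β' := ((hM0 α).trans_lt hlt).trans_le
      (hmono self_mem_Ici (mem_Ici.2 (le_max_left _ _)) (le_max_left _ _))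
    -- The constant absorbs the integral from `Θbar` to `β' + 3`, which the growth estimate does not
    -- see.
    have hgrowth : ∀ᶠ θ in atTop,
        M β' * Real.exp (-(1 / 4 * ∫ ζ in Θbar..(β' + 3), κ ^ m ζ)) *
          Real.exp (1 / 4 * ∫ ζ in Θbar..θ, κ ^ m ζ) ≤ M θ := by
      filter_upwards [eventually_ge_atTop (β' + 1)] with θ hθ
      refine le_trans ?_ (growth_of_monotoneOn hg (fun θ _ => (hgpos θ).le)
        (fun θ h => Real.rpow_le_one hb.κ_pos.le hb.κ_lt_one.le (hb.nonneg θ (haΘ.trans h)))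
        hβ' hMβ (hmono.mono (Ici_subset_Ici.2 (le_max_left _ _))) hstep hθ)
      rw [mul_assoc, ← Real.exp_add]
      refine mul_le_mul_of_nonneg_left (Real.exp_le_exp.2 ?_) hMβ.le
      have hii : ∀ {s t}, a ≤ s → a ≤ t → IntervalIntegrable (fun ζ => κ ^ m ζ) volume s t :=
        fun h h' => hg.intervalIntegrable_of_le h h'
      have hθa : a ≤ θ := by linarith
      have h1 := intervalIntegral.integral_add_adjacent_intervals
        (hgΘ.intervalIntegrable_of_le le_rfl (show Θbar ≤ β' + 3 by linarith))
        (hgΘ.intervalIntegrable_of_le (show Θbar ≤ β' + 3 by linarith)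
          (show Θbar ≤ θ by linarith))
      have h2 := intervalIntegral.integral_add_adjacent_intervals
        (hii (show a ≤ β' + 3 by linarith) hθa) (hii hθa (show a ≤ θ + 1 by linarith))
      have h3 := intervalIntegral.integral_nonneg (μ := volume) (f := fun ζ => κ ^ m ζ)
        (show θ ≤ θ + 1 by linarith) fun x _ => (hgpos x).le
      linarith
    refine ⟨⟨_, mul_pos hMβ (Real.exp_pos _), hgrowth⟩, ?_⟩
    refine tendsto_atTop_mono' _ hgrowth (Tendsto.const_mul_atTop
      (mul_pos hMβ (Real.exp_pos _)) (Real.tendsto_exp_atTop.comp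
        (hb.diverges.const_mul_atTop (by norm_num))))
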